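/- Let $k\ge 1$, let $c_1,\dots,c_k\in\mathbb{C}$ be distinct, let $A_1,\dots,A_k\in\mathbb{C}$, and set $$\phi(z)=-\frac32\sum_{i=1}^k\frac{A_i(z-c_i)+1}{(z-c_i)^2},\qquad L_i=3A_i^2-4\sum_{j\ne i}\frac{A_j(c_i-c_j)+1}{(c_i-c_j)^2}\quad(1\le i\le k),$$ $$E_1=\sum_{i=1}^k A_i,\qquad E_2=\sum_{i=1}^k(1+c_iA_i).$$ For a non-constant polynomial $P$ let $S_P=\left(\frac{P''}{P'}\right)'-\frac12\left(\frac{P''}{P'}\right)^2$ be its Schwarzian derivative, a meromorphic function on $\mathbb{C}$. (1) If $\phi=S_P$ (as meromorphic functions on $\mathbb{C}$) for a polynomial $P$ with $P'(z)=\prod_{i=1}^k(z-c_i)$, then $$A_i=\frac23\sum_{j\ne i}\frac1{c_i-c_j}\quad(1\le i\le k),$$ and moreover $L_i=0$ for $1\le i\le k$, $E_1=0$ and $-\frac32E_2=\frac{1-(k+1)^2}{2}$. (2) Conversely, if $L_i=0$ for $1\le i\le k$, $E_1=0$ and $-\frac32E_2=\frac{1-(k+1)^2}{2}$, then there is a polynomial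 $P$ with $P'(z)=\prod_{i=1}^k(z-c_i)$ and $\phi=S_P$. -/

import Mathlib

open Polynomial

namespace SchwarzPoly

/-- The Schwarzian derivative `(f''/f')' - (1/2) (f''/f')^2` of a complex-valued function
of one complex variable (meaningful at the points where `f` is holomorphic and `f' ≠ 0`). -/
noncomputable def schwarzian (f : ℂ → ℂ) (z : ℂ) : ℂ :=
  deriv (fun w => deriv (deriv f) w / deriv f w) z
    - (1 / 2) * (deriv (deriv f) z / deriv f z) ^ 2

variable {k : ℕ}

/-- The rational function `φ(z) = -(3/2) ∑ i, (A_i (z - c_i) + 1) / (z - c_i)^2`. -/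
noncomputable def phi (c A : Fin k → ℂ) (z : ℂ) : ℂ :=
  -(3 / 2) * ∑ i, (A i * (z - c i) + 1) / (z - c i) ^ 2

/-- `L_i = 3 A_i^2 - 4 ∑_{j ≠ i} (A_j (c_i - c_j) + 1) / (c_i - c_j)^2`. -/
noncomputable def L (c A : Fin k → ℂ) (i : Fin k) : ℂ :=
  3 * A i ^ 2 - 4 * ∑ j ∈ Finset.univ.erase i, (A j * (c i - c j) + 1) / (c i - c j) ^ 2

/-- `E_{m+1} = ∑ i, (m c_i^(m-1) + c_i^m A_i)` for `m ≥ 0`, so that the expansion of `φ` at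
infinity is `-(3/2) ∑_{n ≥ 1} E_n / z^n`; accordingly `E_0 = 0`. For `m = 0` the first summand
is `0`. -/
noncomputable def E (c A : Fin k → ℂ) : ℕ → ℂ
  | 0 => 0
  | m + 1 => ∑ i, ((m : ℂ) * c i ^ (m - 1) + c i ^ m * A i)

/-- `φ = S_P` as meromorphic functions on `ℂ`, where `φ` is the function attached to the distinct
points `c_i` and the numbers `A_i`, and `P` is a polynomial whose critical points are the `c_i`:
the two functions agree at every point of `ℂ` other than the `c_i`. -/
def PhiEqSchwarzian (c A : Fin k → ℂ) (P : ℂ[X]) : Prop :=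
  ∀ z : ℂ, z ∉ Set.range c → phi c A z = schwarzian (fun w => P.eval w) z

end SchwarzPoly

/-! Put `s_i = ∑_{j ≠ i} 1/(c_i - c_j)` and `A_i = (2/3) s_i + (4/3) r_i`. The double poles of `φ`
and `S_P` agree, and `φ - S_P = -2 ∑ r_i/(z - c_i)`, so `φ = S_P` exactly when `r = 0`
(`phiEqSchwarzian_iff`). The values of `L_i`, `E_1`, `E_2` at `r = 0` give (1).

For (2), the hypotheses become `s_i r_i + r_i^2 = ∑_{j ≠ i} r_j/(c_i - c_j)` and `∑ r_i = ∑ r_i c_i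
= 0`. Take a nonzero polynomial `u` of degree at most `k` with `u'(c_i) + r_i u(c_i) = 0` for all
`i`. Then `Q u'' - Q' u' - R u` has degree below `2k` and a double root at each `c_i`, so it
vanishes (`odeOp_eq_zero`). The conditions at infinity lower the degree of `R`, so the top
coefficient forces `n (n - 1 - k) = 0` with `n = deg u ≤ k`. Hence `u` is constant, `R = 0` and `r =
0` (`deviation_eq_zero`). -/

namespace SchwarzPoly

open Finset Lagrange

/-! ### Sums over the differences of the nodes -/

section Sums

variable {k : ℕ}

/-- `∑_{j ≠ i} 1 / (c_i - c_j)`; the term `j = i` vanishes since `0⁻¹ = 0`. -/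
noncomputable def invDiffSum (c : Fin k → ℂ) (i : Fin k) : ℂ := ∑ j, (c i - c j)⁻¹

theorem sum_erase_one_div_sub (c : Fin k → ℂ) (i : Fin k) :
    ∑ j ∈ univ.erase i, 1 / (c i - c j) = invDiffSum c i := by
  rw [sum_erase _ (by simp), invDiffSum]
  simp

theorem mul_add_one_div_sq (a x : ℂ) : (a * x + 1) / x ^ 2 = a * x⁻¹ + x⁻¹ ^ 2 := by
  rcases eq_or_ne x 0 with rfl | hx
  · simp
  · field_simp

theorem L_eq (c A : Fin k → ℂ) (i : Fin k) :
    L c A i = 3 * A i ^ 2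
      - 4 * (∑ j, A j * (c i - c j)⁻¹ + ∑ j, (c i - c j)⁻¹ ^ 2) := by
  rw [L, sum_erase _ (by simp), ← sum_add_distrib]
  simp_rw [mul_add_one_div_sq]

theorem sum_sum_swap_eq_zero {f : Fin k → Fin k → ℂ} (h : ∀ i j, f j i = -f i j) :
    ∑ i, ∑ j, f i j = 0 := by
  have h1 : ∑ i, ∑ j, f i j = -∑ i, ∑ j, f i j := by
    conv_lhs => rw [sum_comm]
    simp_rw [← sum_neg_distrib]
    exact sum_congr rfl fun i _ => sum_congr rfl fun j _ => h i j
  exact self_eq_neg.mp h1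

theorem sum_invDiffSum (c : Fin k → ℂ) : ∑ i, invDiffSum c i = 0 :=
  sum_sum_swap_eq_zero fun i j => by rw [← neg_sub, inv_neg]

theorem sum_mul_invDiffSum {c : Fin k → ℂ} (hc : Function.Injective c) :
    2 * ∑ i, c i * invDiffSum c i = (k : ℂ) * (k - 1) := by
  have h1 : ∑ i, ∑ j, (c i * (c i - c j)⁻¹ + c j * (c i - c j)⁻¹) = 0 :=
    sum_sum_swap_eq_zero fun i j => by rw [← neg_sub (c i), inv_neg]; ring
  have h2 : ∑ i, ∑ j, (c i * (c i - c j)⁻¹ - c j * (c i - c j)⁻¹) = (k : ℂ) * (k - 1) := by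
    have h : ∀ i j, c i * (c i - c j)⁻¹ - c j * (c i - c j)⁻¹ = 1 - if i = j then 1 else 0 := by
      intro i j
      split_ifs with hij
      · simp [hij]
      · rw [← sub_mul, mul_inv_cancel₀ (sub_ne_zero.mpr (hc.ne hij)), sub_zero]
    simp [h, mul_sub]
  simp only [sum_sub_distrib, sum_add_distrib] at h1 h2
  simp only [invDiffSum, mul_sum]
  simp only [← mul_sum] at h1 h2 ⊢
  linear_combination h1 + h2

/-- For distinct indices this is a partial fraction identity. The corrections come from `0⁻¹ = 0`
when indices coincide; summed over `j` and `l`, they give the `3` in `sum_invDiffSum_mul_inv`. -/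
theorem inv_sub_cyclic {c : Fin k → ℂ} (hc : Function.Injective c) (i j l : Fin k) :
    (c i - c j)⁻¹ * (c j - c l)⁻¹ + (c i - c l)⁻¹ * (c l - c j)⁻¹ =
      (c i - c j)⁻¹ * (c i - c l)⁻¹ - (if j = l then (c i - c j)⁻¹ ^ 2 else 0)
        - (if i = j then (c i - c l)⁻¹ ^ 2 else 0)
        - (if i = l then (c i - c j)⁻¹ ^ 2 else 0) := by
  have neg_inv : ∀ a b : Fin k, (c a - c b)⁻¹ = -(c b - c a)⁻¹ := fun a b => by
    rw [← neg_sub, inv_neg]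
  by_cases hjl : j = l
  · subst hjl
    by_cases hij : i = j
    · simp [hij]
    · simp [hij, sq]
  by_cases hij : i = j
  · subst hij
    rw [neg_inv l i]
    simp [hjl, sq]
  by_cases hil : i = l
  · subst hil
    rw [neg_inv j i]
    simp [hjl, hij, sq]
  · have h1 := sub_ne_zero.mpr (hc.ne hjl)
    have h2 := sub_ne_zero.mpr (hc.ne hij)
    have h3 := sub_ne_zero.mpr (hc.ne hil)
    rw [neg_inv l j]
    simp only [hjl, hij, hil, if_false]
    field_simp
    ring

theorem sum_invDiffSum_mul_inv {c : Fin k → ℂ} (hc : Function.Injective c) (i : Fin k) :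
    2 * ∑ j, invDiffSum c j * (c i - c j)⁻¹ =
      invDiffSum c i ^ 2 - 3 * ∑ j, (c i - c j)⁻¹ ^ 2 := by
  have h1 : ∑ j, invDiffSum c j * (c i - c j)⁻¹ =
      ∑ j, ∑ l, (c i - c j)⁻¹ * (c j - c l)⁻¹ := by
    simp_rw [invDiffSum, sum_mul, mul_comm]
  have h2 : ∑ j, invDiffSum c j * (c i - c j)⁻¹ =
      ∑ j, ∑ l, (c i - c l)⁻¹ * (c l - c j)⁻¹ := by rw [h1, sum_comm]
  have h3 : invDiffSum c i ^ 2 = ∑ j, ∑ l, (c i - c j)⁻¹ * (c i - c l)⁻¹ := by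
    rw [sq, invDiffSum, sum_mul_sum]
  have h4 := sum_congr (rfl : (univ : Finset (Fin k)) = univ) fun j _ =>
    sum_congr (rfl : (univ : Finset (Fin k)) = univ) fun l _ => inv_sub_cyclic hc i j l
  simp only [sum_sub_distrib, sum_add_distrib, ← h1, ← h2, ← h3] at h4
  have h5 : ∑ j, ∑ l, (if i = j then (c i - c l)⁻¹ ^ 2 else 0) = ∑ l, (c i - c l)⁻¹ ^ 2 := by
    rw [sum_comm]; simp
  rw [h5] at h4
  simp only [sum_ite_eq, mem_univ, if_true] at h4
  linear_combination h4

/-- `L_i` in terms of the deviation `r` of `A` from `(2/3) ∑_{j ≠ i} 1 / (c_i - c_j)`. -/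
theorem L_eq_of_deviation {c A r : Fin k → ℂ} (hc : Function.Injective c)
    (hA : ∀ i, A i = 2 / 3 * invDiffSum c i + 4 / 3 * r i) (i : Fin k) :
    L c A i = 16 / 3 * (invDiffSum c i * r i + r i ^ 2 - ∑ j, r j * (c i - c j)⁻¹) := by
  have h := sum_invDiffSum_mul_inv hc i
  rw [L_eq]
  simp only [hA, add_mul, sum_add_distrib, mul_assoc, ← mul_sum]
  linear_combination (-4 / 3) * h

theorem E_one_eq_of_deviation {c A r : Fin k → ℂ}
    (hA : ∀ i, A i = 2 / 3 * invDiffSum c i + 4 / 3 * r i) : E c A 1 = 4 / 3 * ∑ i, r i := by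
  simp [E, hA, sum_add_distrib, ← mul_sum, sum_invDiffSum]

theorem E_two_eq_of_deviation {c A r : Fin k → ℂ} (hc : Function.Injective c)
    (hA : ∀ i, A i = 2 / 3 * invDiffSum c i + 4 / 3 * r i) :
    E c A 2 = (k ^ 2 + 2 * k) / 3 + 4 / 3 * ∑ i, r i * c i := by
  have h := sum_mul_invDiffSum hc
  have h1 : E c A 2 = ∑ i : Fin k, (1 : ℂ)
      + 2 / 3 * ∑ i, c i * invDiffSum c i + 4 / 3 * ∑ i, r i * c i := by
    rw [mul_sum, mul_sum, ← sum_add_distrib, ← sum_add_distrib]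
    refine sum_congr rfl fun i _ => ?_
    simp only [hA]
    push_cast
    ring
  rw [h1, sum_const, card_univ, Fintype.card_fin, nsmul_one]
  linear_combination h / 3

end Sums

/-! ### Numerators of partial fractions and their values at the nodes -/

section PartialFractions

variable {k : ℕ}

/-- The polynomial `∑ i, r_i ∏_{j ≠ i} (X - c_j)`, the numerator of `∑ i, r_i / (X - c_i)`. -/
noncomputable def numerator (c r : Fin k → ℂ) : ℂ[X] := ∑ i, C (r i) * nodal (univ.erase i) c

theorem nodal_univ_eq (c : Fin k → ℂ) (i : Fin k) :
    nodal univ c = (X - C (c i)) * nodal (univ.erase i) c :=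
  nodal_eq_mul_nodal_erase (mem_univ i)

theorem eval_nodal_univ_ne_zero {c : Fin k → ℂ} {z : ℂ} (hz : z ∉ Set.range c) :
    (nodal univ c).eval z ≠ 0 :=
  eval_nodal_not_at_node fun i _ h => hz ⟨i, h.symm⟩

theorem eval_numerator (c r : Fin k → ℂ) {z : ℂ} (hz : z ∉ Set.range c) :
    (numerator c r).eval z = (nodal univ c).eval z * ∑ i, r i * (z - c i)⁻¹ := by
  rw [numerator, eval_finsetSum, mul_sum]
  refine sum_congr rfl fun i _ => ?_
  have h : z - c i ≠ 0 := sub_ne_zero.mpr fun h => hz ⟨i, h.symm⟩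
  rw [nodal_univ_eq c i]
  simp only [eval_mul, eval_C, eval_sub, eval_X]
  field_simp

theorem eval_nodal_erase_of_ne (c : Fin k → ℂ) {i l : Fin k} (h : l ≠ i) :
    (nodal (univ.erase l) c).eval (c i) = 0 :=
  eval_nodal_at_node (mem_erase.mpr ⟨h.symm, mem_univ i⟩)

theorem eval_derivative_nodal_ne_zero {c : Fin k → ℂ} (hc : Function.Injective c) (i : Fin k) :
    (derivative (nodal univ c)).eval (c i) ≠ 0 := by
  rw [eval_nodal_derivative_eval_node_eq (mem_univ i)]
  exact eval_nodal_not_at_node fun j hj h => (mem_erase.mp hj).1 (hc h.symm)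

theorem eval_numerator_node (c r : Fin k → ℂ) (i : Fin k) :
    (numerator c r).eval (c i) = r i * (derivative (nodal univ c)).eval (c i) := by
  rw [numerator, eval_finsetSum, sum_eq_single i, eval_nodal_derivative_eval_node_eq (mem_univ i)]
  · simp
  · intro l _ hl
    simp [eval_nodal_erase_of_ne c hl]
  · simp

theorem eq_zero_of_numerator_eq_zero {c r : Fin k → ℂ} (hc : Function.Injective c)
    (h : numerator c r = 0) : r = 0 := by
  funext i
  have h1 := eval_numerator_node c r i
  rw [h, eval_zero, zero_eq_mul] at h1
  exact h1.resolve_right (eval_derivative_nodal_ne_zero hc i)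

theorem eval_derivative_nodal_erase_of_ne {c : Fin k → ℂ} (hc : Function.Injective c)
    {i l : Fin k} (h : l ≠ i) :
    (derivative (nodal (univ.erase l) c)).eval (c i) =
      (derivative (nodal univ c)).eval (c i) * (c i - c l)⁻¹ := by
  have h1 := congrArg (fun p => (derivative p).eval (c i)) (nodal_univ_eq c l)
  simp [derivative_mul, eval_nodal_erase_of_ne c h] at h1
  have h2 : c i - c l ≠ 0 := sub_ne_zero.mpr (hc.ne h.symm)
  rw [h1]
  field_simp

theorem eval_derivative_derivative_nodal_eq_two_mul (c : Fin k → ℂ) (i : Fin k) :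
    (derivative (derivative (nodal univ c))).eval (c i) =
      2 * (derivative (nodal (univ.erase i) c)).eval (c i) := by
  rw [nodal_univ_eq c i]
  simp [derivative_mul]
  ring

theorem eval_derivative_numerator_aux {c : Fin k → ℂ} (hc : Function.Injective c)
    (r : Fin k → ℂ) (i : Fin k) :
    (derivative (numerator c r)).eval (c i) =
      r i * (derivative (nodal (univ.erase i) c)).eval (c i)
        + (derivative (nodal univ c)).eval (c i) * ∑ j, r j * (c i - c j)⁻¹ := by
  rw [numerator, derivative_sum, eval_finsetSum, ← add_sum_erase _ _ (mem_univ i),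
    ← add_sum_erase univ (fun j => r j * (c i - c j)⁻¹) (mem_univ i)]
  simp only [derivative_C_mul, eval_C_mul, sub_self, inv_zero, mul_zero, zero_add, mul_sum]
  congr 1
  refine sum_congr rfl fun l hl => ?_
  rw [eval_derivative_nodal_erase_of_ne hc (mem_erase.mp hl).1]
  ring

theorem numerator_one (c : Fin k → ℂ) :
    numerator c (fun _ => 1) = derivative (nodal univ c) := by
  simp [numerator, derivative_nodal]

theorem eval_derivative_nodal_erase_self {c : Fin k → ℂ} (hc : Function.Injective c)
    (i : Fin k) :
    (derivative (nodal (univ.erase i) c)).eval (c i) =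
      (derivative (nodal univ c)).eval (c i) * invDiffSum c i := by
  have h1 := eval_derivative_numerator_aux hc (fun _ => 1) i
  rw [numerator_one, eval_derivative_derivative_nodal_eq_two_mul] at h1
  simp only [one_mul] at h1
  rw [invDiffSum]
  linear_combination h1

/-- Since `z/(z - a) = 1 + a/(z - a)`, each vanishing moment allows one more factor `X` without
raising the degree bound. -/
theorem X_sq_mul_numerator {c r : Fin k → ℂ} (h1 : ∑ i, r i = 0) (h2 : ∑ i, r i * c i = 0) :
    X ^ 2 * numerator c r = numerator c (fun i => r i * c i * c i) := by
  have step : ∀ r : Fin k → ℂ, ∑ i, r i = 0 →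
      X * numerator c r = numerator c (fun i => r i * c i) := by
    intro r hr
    have h : X * numerator c r
        = C (∑ i, r i) * nodal univ c + numerator c (fun i => r i * c i) := by
      simp only [numerator, mul_sum, map_sum, sum_mul, ← sum_add_distrib]
      refine sum_congr rfl fun i _ => ?_
      rw [nodal_univ_eq c i, C_mul]
      ring
    rw [h, hr, C_0, zero_mul, zero_add]
  rw [sq, mul_assoc, step r h1, step _ h2]

theorem natDegree_numerator_le (c r : Fin k → ℂ) : (numerator c r).natDegree ≤ k - 1 := by
  refine natDegree_sum_le_of_forall_le _ _ fun i _ => ?_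
  refine (natDegree_C_mul_le _ _).trans ?_
  simp [natDegree_nodal, card_erase_of_mem]

end PartialFractions

/-! ### Comparison of `φ` with the Schwarzian derivative -/

section Schwarzian

variable {k : ℕ}

theorem phi_eq (c A : Fin k → ℂ) (z : ℂ) :
    phi c A z = -(3 / 2) * (∑ i, A i * (z - c i)⁻¹ + ∑ i, (z - c i)⁻¹ ^ 2) := by
  simp_rw [phi, mul_add_one_div_sq, sum_add_distrib]

theorem deriv_deriv_div_deriv {c : Fin k → ℂ} {P : ℂ[X]} (hP : derivative P = nodal univ c)
    {z : ℂ} (hz : z ∉ Set.range c) :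
    deriv (deriv fun w => P.eval w) z / deriv (fun w => P.eval w) z = ∑ i, (z - c i)⁻¹ := by
  have h : (deriv fun w => P.eval w) = fun w => (nodal univ c).eval w := by
    funext w; rw [Polynomial.deriv, hP]
  rw [h, Polynomial.deriv, ← numerator_one, eval_numerator c _ hz,
    mul_div_cancel_left₀ _ (eval_nodal_univ_ne_zero hz)]
  simp

theorem schwarzian_eq {c : Fin k → ℂ} {P : ℂ[X]} (hP : derivative P = nodal univ c)
    {z : ℂ} (hz : z ∉ Set.range c) :
    schwarzian (fun w => P.eval w) z =
      -∑ i, (z - c i)⁻¹ ^ 2 - 1 / 2 * (∑ i, (z - c i)⁻¹) ^ 2 := by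
  have hev : (fun w => deriv (deriv fun w => P.eval w) w / deriv (fun w => P.eval w) w)
      =ᶠ[nhds z] fun w => ∑ i, (w - c i)⁻¹ := by
    filter_upwards [(Set.finite_range c).isClosed.isOpen_compl.mem_nhds hz] with w hw
    exact deriv_deriv_div_deriv hP hw
  have hd : HasDerivAt (fun w => ∑ i, (w - c i)⁻¹) (∑ i, -(z - c i)⁻¹ ^ 2) z := by
    refine HasDerivAt.fun_sum fun i _ => ?_
    have hne : z - c i ≠ 0 := sub_ne_zero.mpr fun h => hz ⟨i, h.symm⟩
    have h : HasDerivAt (fun w => (w - c i)⁻¹) (-1 / (z - c i) ^ 2) z :=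
      ((hasDerivAt_id z).sub_const (c i)).fun_inv hne
    rwa [neg_div, one_div, ← inv_pow] at h
  rw [schwarzian, hev.deriv_eq, hd.deriv, deriv_deriv_div_deriv hP hz, sum_neg_distrib]

theorem sum_inv_sub_sq {c : Fin k → ℂ} (hc : Function.Injective c) {z : ℂ}
    (hz : z ∉ Set.range c) :
    (∑ i, (z - c i)⁻¹) ^ 2 =
      ∑ i, (z - c i)⁻¹ ^ 2 + 2 * ∑ i, invDiffSum c i * (z - c i)⁻¹ := by
  have h : ∀ i j, (z - c i)⁻¹ * (z - c j)⁻¹ =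
      (c i - c j)⁻¹ * (z - c i)⁻¹ + (c j - c i)⁻¹ * (z - c j)⁻¹
        + if i = j then (z - c i)⁻¹ ^ 2 else 0 := by
    intro i j
    by_cases hij : i = j
    · simp [hij, sq]
    have h1 : z - c i ≠ 0 := sub_ne_zero.mpr fun h => hz ⟨i, h.symm⟩
    have h2 : z - c j ≠ 0 := sub_ne_zero.mpr fun h => hz ⟨j, h.symm⟩
    have h3 : c i - c j ≠ 0 := sub_ne_zero.mpr (hc.ne hij)
    rw [← neg_sub (c i) (c j), inv_neg, if_neg hij]
    field_simp
    ring
  rw [sq, sum_mul_sum]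
  simp only [h, sum_add_distrib, sum_ite_eq, mem_univ, if_true]
  rw [sum_comm (f := fun i j => (c j - c i)⁻¹ * (z - c j)⁻¹)]
  simp only [invDiffSum, sum_mul]
  ring

theorem phi_sub_schwarzian {c A r : Fin k → ℂ} (hc : Function.Injective c)
    (hA : ∀ i, A i = 2 / 3 * invDiffSum c i + 4 / 3 * r i) {P : ℂ[X]}
    (hP : derivative P = nodal univ c) {z : ℂ} (hz : z ∉ Set.range c) :
    phi c A z - schwarzian (fun w => P.eval w) z = -2 * ∑ i, r i * (z - c i)⁻¹ := by
  rw [phi_eq, schwarzian_eq hP hz, sum_inv_sub_sq hc hz]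
  simp only [hA, add_mul, sum_add_distrib, mul_assoc, ← mul_sum]
  ring

theorem phiEqSchwarzian_iff {c A r : Fin k → ℂ} (hc : Function.Injective c)
    (hA : ∀ i, A i = 2 / 3 * invDiffSum c i + 4 / 3 * r i) {P : ℂ[X]}
    (hP : derivative P = nodal univ c) : PhiEqSchwarzian c A P ↔ r = 0 := by
  constructor
  · intro h
    refine eq_zero_of_numerator_eq_zero hc (eq_zero_of_infinite_isRoot _ ?_)
    refine (Set.finite_range c).infinite_compl.mono fun z hz => ?_
    have h1 := phi_sub_schwarzian hc hA hP hz
    rw [h z hz, sub_self, zero_eq_mul] at h1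
    rw [Set.mem_ofPred_eq, IsRoot, eval_numerator c r hz, h1.resolve_left (by norm_num), mul_zero]
  · rintro rfl z hz
    simpa [sub_eq_zero] using phi_sub_schwarzian hc hA hP hz

end Schwarzian

/-! ### Vanishing of the deviation through a differential equation -/

section Rigidity

variable {k : ℕ}

/-- The operator `u ↦ Q u'' - Q' u' - R u` with `Q = ∏ (X - c_i)` and `R = ∑ r_i Q / (X - c_i)`:
the equation `y'' + (φ / 2) y = 0` after the substitution `y = Q^(-1/2) u`. -/
noncomputable def odeOp (c r : Fin k → ℂ) (u : ℂ[X]) : ℂ[X] :=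
  nodal univ c * derivative (derivative u) - derivative (nodal univ c) * derivative u
    - numerator c r * u

/-- There are `k` linear conditions on a space of dimension `k + 1`. -/
theorem exists_ne_zero_eval_derivative_add (c r : Fin k → ℂ) :
    ∃ u : ℂ[X], u ≠ 0 ∧ u.natDegree ≤ k ∧
      ∀ i, (derivative u).eval (c i) + r i * u.eval (c i) = 0 := by
  let T : ℂ[X] →ₗ[ℂ] (Fin k → ℂ) :=
    LinearMap.pi fun i => leval (c i) ∘ₗ derivative + r i • leval (c i)
  have hlt : Module.finrank ℂ (Fin k → ℂ) < Module.finrank ℂ (degreeLT ℂ (k + 1)) := by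
    rw [(degreeLTEquiv ℂ (k + 1)).finrank_eq]
    simp
  have : Module.Finite ℂ (degreeLT ℂ (k + 1)) :=
    Module.Finite.equiv (degreeLTEquiv ℂ (k + 1)).symm
  obtain ⟨u, hu, hne⟩ := (Submodule.ne_bot_iff _).mp
    (LinearMap.ker_ne_bot_of_finrank_lt (f := T ∘ₗ (degreeLT ℂ (k + 1)).subtype) hlt)
  refine ⟨u, fun h => hne (Subtype.ext h), ?_, fun i => congrFun hu i⟩
  have h := mem_degreeLT.mp u.2
  exact Nat.lt_succ_iff.mp ((natDegree_lt_iff_degree_lt fun h => hne (Subtype.ext h)).mpr h)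

theorem natDegree_odeOp_lt (hk : 1 ≤ k) (c r : Fin k → ℂ) {u : ℂ[X]} (hu : u.natDegree ≤ k) :
    (odeOp c r u).natDegree < 2 * k := by
  have hQ : (nodal univ c).natDegree = k := by simp [natDegree_nodal]
  have h1 := natDegree_derivative_le u
  have h2 := natDegree_derivative_le (derivative u)
  have h3 := natDegree_derivative_le (nodal univ c)
  have h4 := natDegree_numerator_le c r
  have h5 := natDegree_mul_le (p := nodal univ c) (q := derivative (derivative u))
  have h6 := natDegree_mul_le (p := derivative (nodal univ c)) (q := derivative u)
  have h7 := natDegree_mul_le (p := numerator c r) (q := u)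
  have h8 := natDegree_sub_le (nodal univ c * derivative (derivative u)
    - derivative (nodal univ c) * derivative u) (numerator c r * u)
  have h9 := natDegree_sub_le (nodal univ c * derivative (derivative u))
    (derivative (nodal univ c) * derivative u)
  rw [odeOp]
  omega

theorem X_sub_C_sq_dvd {p : ℂ[X]} {a : ℂ} (h0 : p.eval a = 0)
    (h1 : (derivative p).eval a = 0) : (X - C a) ^ 2 ∣ p := by
  obtain ⟨q, rfl⟩ := dvd_iff_isRoot.mpr h0
  rw [sq]
  refine mul_dvd_mul_left _ (dvd_iff_isRoot.mpr ?_)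
  simpa [derivative_mul] using h1

theorem eq_zero_of_double_roots {c : Fin k → ℂ} (hc : Function.Injective c) {p : ℂ[X]}
    (hdeg : p.natDegree < 2 * k) (h0 : ∀ i, p.eval (c i) = 0)
    (h1 : ∀ i, (derivative p).eval (c i) = 0) : p = 0 := by
  have hdvd : ∏ i, (X - C (c i)) ^ 2 ∣ p := by
    refine Finset.prod_dvd_of_coprime (fun i _ j _ hij => ?_) fun i _ =>
      X_sub_C_sq_dvd (h0 i) (h1 i)
    exact (pairwise_coprime_X_sub_C hc hij).pow
  refine eq_zero_of_dvd_of_natDegree_lt hdvd ?_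
  rw [prod_pow, natDegree_pow, natDegree_finsetProd_X_sub_C_eq_card]
  simpa using hdeg

theorem odeOp_eq_zero (hk : 1 ≤ k) {c r : Fin k → ℂ} (hc : Function.Injective c)
    (hr : ∀ i, invDiffSum c i * r i + r i ^ 2 = ∑ j, r j * (c i - c j)⁻¹)
    {u : ℂ[X]} (hu : u.natDegree ≤ k)
    (h : ∀ i, (derivative u).eval (c i) + r i * u.eval (c i) = 0) : odeOp c r u = 0 := by
  have hQ : ∀ i, (nodal univ c).eval (c i) = 0 := fun i => eval_nodal_at_node (mem_univ i)
  refine eq_zero_of_double_roots hc (natDegree_odeOp_lt hk c r hu) (fun i => ?_) fun i => ?_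
  · simp only [odeOp, eval_sub, eval_mul, hQ, eval_numerator_node]
    linear_combination (-(derivative (nodal univ c)).eval (c i)) * h i
  · simp only [odeOp, derivative_sub, derivative_mul, eval_sub, eval_add, eval_mul, hQ,
      eval_numerator_node, eval_derivative_derivative_nodal_eq_two_mul,
      eval_derivative_numerator_aux hc, eval_derivative_nodal_erase_self hc, ← hr i]
    -- The `u''` terms cancel. The relation `hr`, equivalent to `L_i = 0`, makes the rest a multiple
    -- of `u' + r_i u` at `c_i`.
    linear_combination (-(derivative (nodal univ c)).eval (c i)
      * (2 * invDiffSum c i + r i)) * h i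

theorem coeff_X_mul_derivative_eq (p : ℂ[X]) (n : ℕ) :
    (X * derivative p).coeff n = n * p.coeff n := by
  cases n with
  | zero => simp
  | succ n => rw [coeff_X_mul, coeff_derivative]; push_cast; ring

theorem natDegree_X_mul_derivative_le {p : ℂ[X]} {n : ℕ} (hp : p.natDegree ≤ n) :
    (X * derivative p).natDegree ≤ n := by
  refine natDegree_le_iff_coeff_eq_zero.mpr fun m hm => ?_
  rw [coeff_X_mul_derivative_eq, coeff_eq_zero_of_natDegree_lt (hp.trans_lt hm), mul_zero]

theorem coeff_X_sq_mul_odeOp (hk : 1 ≤ k) {c r : Fin k → ℂ} (h1 : ∑ i, r i = 0)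
    (h2 : ∑ i, r i * c i = 0) {u : ℂ[X]} {n : ℕ} (hu : u.natDegree ≤ n) :
    (X ^ 2 * odeOp c r u).coeff (k + n) = n * ((n : ℂ) - 1 - k) * u.coeff n := by
  have hQ : (nodal univ c).natDegree = k := by simp [natDegree_nodal]
  have hlead : (nodal univ c).coeff k = 1 := by
    have h := (nodal_monic (s := univ) (v := c)).coeff_natDegree
    rwa [hQ] at h
  -- In terms of the degree-preserving operator `θ = X d/dX`, `X^2 u'' = θ^2 u - θ u`, and `θ`
  -- multiplies the coefficient of `X^n` by `n`.
  have key : X ^ 2 * odeOp c r u =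
      nodal univ c * (X * derivative (X * derivative u)) - nodal univ c * (X * derivative u)
        - (X * derivative (nodal univ c)) * (X * derivative u)
        - numerator c (fun i => r i * c i * c i) * u := by
    rw [← X_sq_mul_numerator h1 h2, odeOp]
    simp only [derivative_mul, derivative_X]
    ring
  have hd := natDegree_X_mul_derivative_le hu
  have hN : (numerator c (fun i => r i * c i * c i) * u).coeff (k + n) = 0 := by
    refine coeff_eq_zero_of_natDegree_lt (natDegree_mul_le.trans_lt ?_)
    have := natDegree_numerator_le c fun i => r i * c i * c i
    omega
  rw [key, coeff_sub, coeff_sub, coeff_sub, hN,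
    coeff_mul_add_eq_of_natDegree_le hQ.le (natDegree_X_mul_derivative_le hd),
    coeff_mul_add_eq_of_natDegree_le hQ.le hd,
    coeff_mul_add_eq_of_natDegree_le (natDegree_X_mul_derivative_le hQ.le) hd]
  simp only [coeff_X_mul_derivative_eq, hlead]
  ring

/-- The only deviation satisfying the conditions at the `c_i` and at infinity is zero. -/
theorem deviation_eq_zero (hk : 1 ≤ k) {c r : Fin k → ℂ} (hc : Function.Injective c)
    (hr : ∀ i, invDiffSum c i * r i + r i ^ 2 = ∑ j, r j * (c i - c j)⁻¹)
    (h1 : ∑ i, r i = 0) (h2 : ∑ i, r i * c i = 0) : r = 0 := by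
  obtain ⟨u, hne, hdeg, hu⟩ := exists_ne_zero_eval_derivative_add c r
  have hode := odeOp_eq_zero hk hc hr hdeg hu
  have hcoeff := coeff_X_sq_mul_odeOp hk h1 h2 (le_refl u.natDegree)
  rw [hode, mul_zero, coeff_zero, zero_eq_mul, mul_eq_zero] at hcoeff
  have hn : u.natDegree = 0 := by
    rcases hcoeff with (h | h) | h
    · exact_mod_cast h
    -- The other exponent at infinity, `k + 1`, is excluded by `deg u ≤ k`.
    · have : (u.natDegree : ℂ) = (k + 1 : ℕ) := by push_cast; linear_combination h
      have := Nat.cast_injective this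
      omega
    · exact absurd (leadingCoeff_eq_zero.mp h) hne
  obtain ⟨a, rfl⟩ := natDegree_eq_zero.mp hn
  refine eq_zero_of_numerator_eq_zero hc ?_
  simpa [odeOp, C_ne_zero.mp hne] using hode

theorem exists_derivative_eq (q : ℂ[X]) : ∃ p : ℂ[X], derivative p = q := by
  induction q using Polynomial.induction_on' with
  | add p q hp hq =>
    obtain ⟨a, rfl⟩ := hp
    obtain ⟨b, rfl⟩ := hq
    exact ⟨a + b, derivative_add⟩
  | monomial n a =>
    refine ⟨monomial (n + 1) (a / (n + 1)), ?_⟩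
    have : (n : ℂ) + 1 ≠ 0 := Nat.cast_add_one_ne_zero n
    rw [derivative_monomial]
    simp [this]

end Rigidity

end SchwarzPoly

theorem theorem5p2 (k : ℕ) (hk : 1 ≤ k) (c : Fin k → ℂ) (hc : Function.Injective c)
    (A : Fin k → ℂ) :
    (∀ P : ℂ[X], derivative P = ∏ i, (X - C (c i)) → SchwarzPoly.PhiEqSchwarzian c A P →
      (∀ i, A i = (2 / 3) * ∑ j ∈ Finset.univ.erase i, 1 / (c i - c j)) ∧
      (∀ i, SchwarzPoly.L c A i = 0) ∧
      SchwarzPoly.E c A 1 = 0 ∧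
      -(3 / 2) * SchwarzPoly.E c A 2 = (1 - ((k : ℂ) + 1) ^ 2) / 2) ∧
    ((∀ i, SchwarzPoly.L c A i = 0) → SchwarzPoly.E c A 1 = 0 →
      -(3 / 2) * SchwarzPoly.E c A 2 = (1 - ((k : ℂ) + 1) ^ 2) / 2 →
      ∃ P : ℂ[X], derivative P = ∏ i, (X - C (c i)) ∧ SchwarzPoly.PhiEqSchwarzian c A P) := by
  have hA : ∀ i, A i = 2 / 3 * SchwarzPoly.invDiffSum c i
      + 4 / 3 * (3 / 4 * A i - 1 / 2 * SchwarzPoly.invDiffSum c i) := fun i => by ring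
  simp_rw [SchwarzPoly.sum_erase_one_div_sub]
  refine ⟨fun P hP hphi => ?_, fun hL hE1 hE2 => ?_⟩
  · have hr := (SchwarzPoly.phiEqSchwarzian_iff hc hA hP).mp hphi
    have hA0 : ∀ i, A i = 2 / 3 * SchwarzPoly.invDiffSum c i + 4 / 3 * (0 : Fin k → ℂ) i := by
      rw [← hr]; exact hA
    refine ⟨fun i => by simpa using hA0 i, fun i => ?_, ?_, ?_⟩
    · simp [SchwarzPoly.L_eq_of_deviation hc hA0]
    · simp [SchwarzPoly.E_one_eq_of_deviation hA0]
    · rw [SchwarzPoly.E_two_eq_of_deviation hc hA0]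
      simp
      ring
  · obtain ⟨P, hP⟩ := SchwarzPoly.exists_derivative_eq (∏ i, (X - C (c i)))
    refine ⟨P, hP, (SchwarzPoly.phiEqSchwarzian_iff hc hA hP).mpr ?_⟩
    rw [SchwarzPoly.E_one_eq_of_deviation hA] at hE1
    rw [SchwarzPoly.E_two_eq_of_deviation hc hA] at hE2
    refine SchwarzPoly.deviation_eq_zero hk hc (fun i => ?_) ?_ ?_
    · have h := hL i
      rw [SchwarzPoly.L_eq_of_deviation hc hA] at h
      linear_combination (3 / 16) * h
    · linear_combination (3 / 4) * hE1
    · linear_combination (-1 / 2) * hE2
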